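/- Let $\mathsf{Pos}$ be the category of posets and monotone maps, and let $G\colon\mathsf{Pos}\to\mathsf{Pos}$ be a functor that is finitary (preserves filtered colimits) and enriched ($f\le g$ pointwise implies $Gf\le Gg$ pointwise) and that preserves order embeddings and surjections. Let $\mathbb{2}=\{\bot<\top\}$. A monotone predicate lifting for $G$ is a family of maps $\lambda_X\colon \mathsf{Pos}(X,\mathbb{2})\to\mathsf{Pos}(GX,\mathbb{2})$ with $\lambda_X(f\cdot h)=\lambda_Y(f)\cdot Gh$ for all monotone $h\colon X\to Y$, $f\colon Y\to\mathbb{2}$. A set $\Lambda$ of monotone predicate liftings is separating if for every poset $X$ and all $t,s\in GX$, whenever $\lambda_X(f)(t)\le\lambda_X(f)(s)$ for all $\lambda\in\Lambda$ and all monotone $f\colon X\to\mathbb{2}$, then $t\le s$. Let $\Lambda$ be separating. Let $\mathbb{G}$ be the graded monad on $\mathsf{Pos}$ with $M_n=G^n$ and with identities as unit and multiplication maps $\eta\colon \mathrm{id}\to M_0$, $\mu^{n,k}\colon M_nM_k\to M_{n+k}$. An $M_0$-algebra is an algebra $(A_0,a^{00}\colon M_0A_0\to A_0)$ for the monad $(M_0,\eta,\mu^{0,0})$.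 An $M_1$-algebra $A$ consists of $M_0$-algebras $(A_0,a^{00})$, $(A_1,a^{01})$ and a map $a^{10}\colon M_1A_0\to A_1$ with $a^{10}\cdot\mu^{0,1}_{A_0}=a^{01}\cdot M_0a^{10}$ and $a^{10}\cdot\mu^{1,0}_{A_0}=a^{10}\cdot M_1a^{00}$. It is canonical if for every $M_1$-algebra $B$ every $M_0$-morphism $h\colon A_0\to B_0$ has a unique extension to an $M_0$-morphism $h^\sharp\colon A_1\to B_1$ with $h^\sharp\cdot a^{10}=b^{10}\cdot M_1h$. The algebras $(M_n1,M_{n+1}1)$, with the multiplications as structure maps, are canonical. Let $\mathcal{L}$ be the graded logic with truth value object $\Omega=\mathbb{2}$ (with the identity as $M_0$-structure), with $\top$ as the only truth constant, with conjunction and disjunction of every finite arity (including the empty conjunction and the empty disjunction) as propositional operators, and with a unary modality for each $\lambda\in\Lambda$, interpreted as $\lambda_{\mathbb{2}}(\mathrm{id})\colon G\mathbb{2}\to\mathbb{2}$. Its formulae of uniform depth $0$ are generated from the truth constant by the propositional operators, and those of uniform depth $n+1$ are generated by the propositional operators from the formulae $\lambda\varphi$ with $\lambda\in\Lambda$ and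 $\varphi$ of uniform depth $n$. For $f\colon A_0\to\Omega$ on a canonical $M_1$-algebra $A$, $[\![\lambda]\!](f)\colon A_1\to\Omega$ is the unique extension of $f$ with $[\![\lambda]\!](f)\cdot a^{10}=\lambda_{\mathbb{2}}(\mathrm{id})\cdot Gf$. Formulae $\varphi$ of depth $n$ are evaluated recursively as maps $[\![\varphi]\!]\colon M_n1\to\Omega$, where $[\![\lambda\varphi]\!]=[\![\lambda]\!]([\![\varphi]\!])$ on $(M_n1,M_{n+1}1)$. For a coalgebra $\gamma\colon X\to GX$ put $\gamma^{(0)}=\eta_X$, $\gamma^{(n+1)}=\mu^{1,n}_X\cdot M_1\gamma^{(n)}\cdot\gamma$ and $[\![\varphi]\!]_\gamma=[\![\varphi]\!]\cdot M_n{!}\cdot\gamma^{(n)}\colon X\to\Omega$, where $!\colon X\to 1$. A set of monotone maps out of a poset $P$ is jointly order-reflecting if, for all $x,y\in P$, $f(x)\le f(y)$ for all $f$ in the set implies $x\le y$. Then: 1. $\mathcal{L}$ is depth-0 separating: the set of evaluations $M_01\to\Omega$ of truth constants is jointly order-reflecting. 2. $\mathcal{L}$ is depth-1 separating: for every canonical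 $M_1$-algebra $A$ and every jointly order-reflecting set $\mathfrak{A}$ of $M_0$-morphisms $A_0\to\Omega$ that is closed under the propositional operators, the set $\{[\![\lambda]\!](f)\mid\lambda\in\Lambda,\ f\in\mathfrak{A}\}$ of maps $A_1\to\Omega$ is jointly order-reflecting. 3. $\mathcal{L}$ is expressive for coalgebraic simulation: for all states $x\in X$, $y\in Y$ in $G$-coalgebras $\gamma\colon X\to GX$, $\delta\colon Y\to GY$, if $[\![\varphi]\!]_\gamma(x)\le[\![\varphi]\!]_\delta(y)$ for all formulae $\varphi$ of every uniform depth, then $M_n{!}\cdot\gamma^{(n)}(x)\le M_n{!}\cdot\delta^{(n)}(y)$ for all $n$, and $y$ $G$-simulates $x$, i.e. there are $G$-coalgebra morphisms $f\colon(X,\gamma)\to(Z,\zeta)$ and $g\colon(Y,\delta)\to(Z,\zeta)$ with $f(x)\le g(y)$. -/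

import Mathlib

open CategoryTheory CategoryTheory.Limits

universe u w₁ w₂ w₃

noncomputable section

namespace GradedSem

/-! ### Posets and functors on posets -/

/-- The one-element poset. -/
abbrev one : PartOrd.{u} := PartOrd.of PUnit.{u + 1}

/-- The unique map into the one-element poset. -/
def bang (X : PartOrd.{u}) : X ⟶ one.{u} :=
  PartOrd.ofHom ⟨fun _ => PUnit.unit, fun _ _ _ => le_rfl⟩

/-- The two-element chain `⊥ < ⊤`. -/
abbrev two : PartOrd.{u} := PartOrd.of (ULift.{u} Bool)

/-- Order embeddings: monotone maps that also reflect the order. -/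
def IsEmbedding {X Y : PartOrd.{u}} (f : X ⟶ Y) : Prop :=
  ∀ x x' : X, f x ≤ f x' → x ≤ x'

/-- Local monotonicity of an endofunctor on posets. -/
def IsEnriched (G : PartOrd.{u} ⥤ PartOrd.{u}) : Prop :=
  ∀ (X Y : PartOrd.{u}) (f g : X ⟶ Y), (∀ x, f x ≤ g x) → ∀ t, G.map f t ≤ G.map g t

def PreservesEmbeddings (G : PartOrd.{u} ⥤ PartOrd.{u}) : Prop :=
  ∀ (X Y : PartOrd.{u}) (f : X ⟶ Y), IsEmbedding f → IsEmbedding (G.map f)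

def PreservesSurjections (G : PartOrd.{u} ⥤ PartOrd.{u}) : Prop :=
  ∀ (X Y : PartOrd.{u}) (f : X ⟶ Y), Function.Surjective f → Function.Surjective (G.map f)

/-- A set of monotone maps `X ⟶ Y` is jointly order-reflecting. -/
def JointlyOrderReflecting {X Y : PartOrd.{u}} (S : Set (X ⟶ Y)) : Prop :=
  ∀ x x' : X, (∀ f ∈ S, f x ≤ f x') → x ≤ x'

/-- The state `y` of `D` simulates the state `x` of `C` with respect to the functor `G`. -/
def Simulates {G : PartOrd.{u} ⥤ PartOrd.{u}} (C D : Endofunctor.Coalgebra G)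
    (x : C.V) (y : D.V) : Prop :=
  ∃ (Z : Endofunctor.Coalgebra G) (f : C ⟶ Z) (g : D ⟶ Z), f.f x ≤ g.f y

/-! ### Graded monads and their algebras -/

/-- A graded monad on the category of posets with grades in `(ℕ, +, 0)`. The multiplication
`T n (T k X) ⟶ T (n + k) X` is indexed by a proof of `n + k = r`, so that no
transport is needed in the laws. -/
structure GradedMonad where
  T : ℕ → PartOrd.{u} ⥤ PartOrd.{u}
  η : 𝟭 PartOrd.{u} ⟶ T 0
  μ : ∀ {n k r : ℕ}, n + k = r → (T k ⋙ T n ⟶ T r)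
  unit_left : ∀ (n : ℕ) (X : PartOrd.{u}),
    η.app ((T n).obj X) ≫ (μ (Nat.zero_add n)).app X = 𝟙 ((T n).obj X)
  unit_right : ∀ (n : ℕ) (X : PartOrd.{u}),
    (T n).map (η.app X) ≫ (μ (Nat.add_zero n)).app X = 𝟙 ((T n).obj X)
  assoc : ∀ {n k m a b r : ℕ} (hnk : n + k = a) (hkm : k + m = b) (ha : a + m = r)
    (hb : n + b = r) (X : PartOrd.{u}),
    (μ hnk).app ((T m).obj X) ≫ (μ ha).app X = (T n).map ((μ hkm).app X) ≫ (μ hb).app X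

variable {M : GradedMonad.{u}}

/-- `M₀`-algebras. -/
structure Alg₀ (M : GradedMonad.{u}) where
  carrier : PartOrd.{u}
  str : (M.T 0).obj carrier ⟶ carrier
  unit : M.η.app carrier ≫ str = 𝟙 carrier
  assoc : (M.μ (Nat.zero_add 0)).app carrier ≫ str = (M.T 0).map str ≫ str

/-- Morphisms of `M₀`-algebras. -/
@[ext]
structure Hom₀ (A B : Alg₀ M) where
  map : A.carrier ⟶ B.carrier
  comm : A.str ≫ map = (M.T 0).map map ≫ B.str

/-- The conditions on a map `M₁ A₀ ⟶ A₁` to be the main structure map of an `M₁`-algebra with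
underlying `M₀`-algebras `A₀` and `A₁`. -/
structure IsMain (A₀ A₁ : Alg₀ M) (a : (M.T 1).obj A₀.carrier ⟶ A₁.carrier) : Prop where
  hom : (M.μ (Nat.zero_add 1)).app A₀.carrier ≫ a = (M.T 0).map a ≫ A₁.str
  coeq : (M.μ (Nat.add_zero 1)).app A₀.carrier ≫ a = (M.T 1).map A₀.str ≫ a

/-- `M₁`-algebras. -/
structure Alg₁ (M : GradedMonad.{u}) where
  zero : Alg₀ M
  one : Alg₀ M
  main : (M.T 1).obj zero.carrier ⟶ one.carrier
  isMain : IsMain zero one main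

/-- `h₁` extends the morphism `h₀` of `0`-parts to a morphism of `M₁`-algebras. -/
def IsExtension (A B : Alg₁ M) (h₀ : Hom₀ A.zero B.zero) (h₁ : Hom₀ A.one B.one) : Prop :=
  A.main ≫ h₁.map = (M.T 1).map h₀.map ≫ B.main

/-- An `M₁`-algebra is canonical if it is free over its `0`-part. -/
def Canonical (A : Alg₁ M) : Prop :=
  ∀ (B : Alg₁ M) (h₀ : Hom₀ A.zero B.zero), ∃! h₁ : Hom₀ A.one B.one, IsExtension A B h₀ h₁

/-- The unique extension of `h₀` along a canonical algebra. -/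
def Canonical.extend {A : Alg₁ M} (hA : Canonical A) (B : Alg₁ M) (h₀ : Hom₀ A.zero B.zero) :
    Hom₀ A.one B.one :=
  (hA B h₀).choose

/-- The `M₀`-algebra `M_n X`. -/
def free₀ (M : GradedMonad.{u}) (n : ℕ) (X : PartOrd.{u}) : Alg₀ M where
  carrier := (M.T n).obj X
  str := (M.μ (Nat.zero_add n)).app X
  unit := M.unit_left n X
  assoc := M.assoc _ _ _ _ X

/-- The `M₁`-algebra `(M_n X, M_{n+1} X)`. -/
def free₁ (M : GradedMonad.{u}) (n : ℕ) (X : PartOrd.{u}) : Alg₁ M where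
  zero := free₀ M n X
  one := free₀ M (n + 1) X
  main := (M.μ (Nat.add_comm 1 n)).app X
  isMain := ⟨M.assoc _ _ _ _ X, M.assoc _ _ _ _ X⟩

/-- The poset `X ^ k`. -/
abbrev powObj (X : PartOrd.{u}) (k : ℕ) : PartOrd.{u} := PartOrd.of (Fin k → X)

/-- The `i`-th projection `X ^ k ⟶ X`. -/
def proj (X : PartOrd.{u}) (k : ℕ) (i : Fin k) : powObj X k ⟶ X :=
  PartOrd.ofHom ⟨fun v => v i, fun _ _ h => h i⟩

/-- Tupling of monotone maps. -/
def tuple {X Y : PartOrd.{u}} {k : ℕ} (f : Fin k → (Y ⟶ X)) : Y ⟶ powObj X k :=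
  PartOrd.ofHom ⟨fun y i => f i y, fun _ _ h i => (f i).hom.monotone h⟩

theorem tuple_proj {X Y : PartOrd.{u}} {k : ℕ} (f : Fin k → (Y ⟶ X)) (i : Fin k) :
    tuple f ≫ proj X k i = f i := rfl

theorem pow_ext {X Y : PartOrd.{u}} {k : ℕ} {f g : Y ⟶ powObj X k}
    (h : ∀ i, f ≫ proj X k i = g ≫ proj X k i) : f = g := by
  ext y i
  exact congrArg (fun q : Y ⟶ X => q y) (h i)

/-- The power `A ^ k` of an `M₀`-algebra, with the componentwise structure. -/
def Alg₀.pow (A : Alg₀ M) (k : ℕ) : Alg₀ M where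
  carrier := powObj A.carrier k
  str := tuple fun i => (M.T 0).map (proj A.carrier k i) ≫ A.str
  unit := by
    refine pow_ext fun i => ?_
    have h := M.η.naturality (proj A.carrier k i)
    simp only [Functor.id_map] at h
    rw [Category.assoc, tuple_proj, ← Category.assoc, ← h, Category.assoc, A.unit]
    exact (Category.comp_id _).trans (Category.id_comp _).symm
  assoc := by
    refine pow_ext fun i => ?_
    have h := (M.μ (Nat.zero_add 0)).naturality (proj A.carrier k i)
    simp only [Functor.comp_map] at h
    rw [Category.assoc, Category.assoc, tuple_proj, ← Category.assoc, ← h, Category.assoc,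
      A.assoc, ← Category.assoc, ← Category.assoc, ← Functor.map_comp, ← Functor.map_comp,
      tuple_proj]

/-- Tupling of morphisms of `M₀`-algebras. -/
def Hom₀.tuple {A B : Alg₀ M} {k : ℕ} (f : Fin k → Hom₀ A B) : Hom₀ A (B.pow k) where
  map := GradedSem.tuple fun i => (f i).map
  comm := by
    refine pow_ext fun i => ?_
    change A.str ≫ (f i).map =
      (M.T 0).map (GradedSem.tuple fun i => (f i).map) ≫ (M.T 0).map (proj B.carrier k i) ≫ B.str
    rw [(f i).comm, ← Category.assoc, ← Functor.map_comp, tuple_proj]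

/-- Composition of morphisms of `M₀`-algebras. -/
def Hom₀.comp {A B C : Alg₀ M} (f : Hom₀ A B) (g : Hom₀ B C) : Hom₀ A C where
  map := f.map ≫ g.map
  comm := by
    rw [← Category.assoc, f.comm, Category.assoc, g.comm, Functor.map_comp, Category.assoc]

/-! ### Graded behavioural preorders -/

variable {G : PartOrd.{u} ⥤ PartOrd.{u}}

/-- The `n`-step behaviour `X ⟶ M_n X` of a coalgebra. -/
def behaviour (α : G ⟶ M.T 1) (C : Endofunctor.Coalgebra G) : ∀ n : ℕ, C.V ⟶ (M.T n).obj C.V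
  | 0 => M.η.app C.V
  | n + 1 => C.str ≫ α.app C.V ≫ (M.T 1).map (behaviour α C n) ≫ (M.μ (Nat.add_comm 1 n)).app C.V

/-- The map `M_n ! ∘ γ⁽ⁿ⁾ : X ⟶ M_n 1`. -/
def behaviourOne (α : G ⟶ M.T 1) (C : Endofunctor.Coalgebra G) (n : ℕ) :
    C.V ⟶ (M.T n).obj one.{u} :=
  behaviour α C n ≫ (M.T n).map (bang C.V)

/-- The state `y` refines the state `x` for the graded behavioural preorder `(α, M)`. -/
def Refines (α : G ⟶ M.T 1) (C D : Endofunctor.Coalgebra G) (x : C.V) (y : D.V) : Prop :=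
  ∀ n : ℕ, behaviourOne α C n x ≤ behaviourOne α D n y

/-! ### Graded logics -/

/-- Syntactic and semantic data of a graded logic with unary modalities. -/
structure GradedLogic (M : GradedMonad.{u}) where
  /-- truth values -/
  Ω : Alg₀ M
  /-- truth constants -/
  Θ : Type w₁
  const : Θ → (one.{u} ⟶ Ω.carrier)
  /-- propositional operators -/
  Op : Type w₂
  arity : Op → ℕ
  op : ∀ p : Op, Hom₀ (Ω.pow (arity p)) Ω
  /-- modalities -/
  Mod : Type w₃
  modality : Mod → ((M.T 1).obj Ω.carrier ⟶ Ω.carrier)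
  isMain : ∀ L : Mod, IsMain Ω Ω (modality L)

variable (𝓛 : GradedLogic.{u, w₁, w₂, w₃} M)

/-- The `M₁`-algebra with both carriers the truth value object that interprets a modality. -/
def GradedLogic.modAlg (L : 𝓛.Mod) : Alg₁ M where
  zero := 𝓛.Ω
  one := 𝓛.Ω
  main := 𝓛.modality L
  isMain := 𝓛.isMain L

/-- Formulae of uniform depth `n`. -/
inductive Formula : ℕ → Type (max w₁ w₂ w₃)
  | const (c : 𝓛.Θ) : Formula 0
  | op {n : ℕ} (p : 𝓛.Op) (φ : Fin (𝓛.arity p) → Formula n) : Formula n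
  | mod {n : ℕ} (L : 𝓛.Mod) (φ : Formula n) : Formula (n + 1)

/-- The interpretation `⟦L⟧(f)` of a modality on a canonical algebra. -/
def GradedLogic.modExt (L : 𝓛.Mod) {A : Alg₁ M} (hA : Canonical A) (f : Hom₀ A.zero 𝓛.Ω) :
    Hom₀ A.one 𝓛.Ω :=
  hA.extend (𝓛.modAlg L) f

/-- The evaluation `M₀ 1 ⟶ Ω` of a truth constant. -/
def GradedLogic.evalConst (c : 𝓛.Θ) : Hom₀ (free₀ M 0 one.{u}) 𝓛.Ω where
  map := (M.T 0).map (𝓛.const c) ≫ 𝓛.Ω.str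
  comm := by
    have h := (M.μ (Nat.zero_add 0)).naturality (𝓛.const c)
    simp only [Functor.comp_map] at h
    change (M.μ (Nat.zero_add 0)).app one.{u} ≫ (M.T 0).map (𝓛.const c) ≫ 𝓛.Ω.str = _
    rw [← Category.assoc, ← h, Category.assoc, 𝓛.Ω.assoc]
    exact (Category.assoc _ _ _).symm.trans
      (congrArg (· ≫ 𝓛.Ω.str) ((M.T 0).map_comp _ _).symm)

/-- The evaluation `M_n 1 ⟶ Ω` of a formula of uniform depth `n`. It makes sense whenever the
`M₁`-algebras `(M_n 1, M_{n+1} 1)` are canonical. -/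
def eval (hM : ∀ n, Canonical (free₁ M n one.{u})) :
    ∀ {n : ℕ}, Formula 𝓛 n → Hom₀ (free₀ M n one.{u}) 𝓛.Ω
  | _, .const c => 𝓛.evalConst c
  | _, .op p φ => (Hom₀.tuple fun i => eval hM (φ i)).comp (𝓛.op p)
  | _, .mod (n := n) L φ => 𝓛.modExt L (A := free₁ M n one.{u}) (hM n) (eval hM φ)

/-- The meaning `X ⟶ Ω` of a formula in a coalgebra. -/
def meaning (hM : ∀ n, Canonical (free₁ M n one.{u})) (α : G ⟶ M.T 1)
    (C : Endofunctor.Coalgebra G) {n : ℕ} (φ : Formula 𝓛 n) : C.V ⟶ 𝓛.Ω.carrier :=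
  behaviourOne α C n ≫ (eval 𝓛 hM φ).map

/-- All formulae true at `x` hold, at least to the same degree, at `y`. -/
def TheoryIncluded (hM : ∀ n, Canonical (free₁ M n one.{u})) (α : G ⟶ M.T 1)
    (C D : Endofunctor.Coalgebra G) (x : C.V) (y : D.V) : Prop :=
  ∀ (n : ℕ) (φ : Formula 𝓛 n), meaning 𝓛 hM α C φ x ≤ meaning 𝓛 hM α D φ y

/-- Expressiveness for `(α, M)`-refinement. -/
def Expressive (hM : ∀ n, Canonical (free₁ M n one.{u})) (α : G ⟶ M.T 1) : Prop :=
  ∀ (C D : Endofunctor.Coalgebra G) (x : C.V) (y : D.V),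
    TheoryIncluded 𝓛 hM α C D x y → Refines α C D x y

/-- Expressiveness for coalgebraic simulation. -/
def ExpressiveForSimulation (hM : ∀ n, Canonical (free₁ M n one.{u})) (α : G ⟶ M.T 1) : Prop :=
  ∀ (C D : Endofunctor.Coalgebra G) (x : C.V) (y : D.V),
    TheoryIncluded 𝓛 hM α C D x y → Simulates C D x y

def DepthZeroSeparating : Prop :=
  JointlyOrderReflecting (Set.range fun c : 𝓛.Θ => (𝓛.evalConst c).map)

/-- Closure of a set of morphisms `A ⟶ Ω` under the propositional operators. -/
def ClosedUnderOps {A : Alg₀ M} (𝔄 : Set (Hom₀ A 𝓛.Ω)) : Prop :=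
  ∀ (p : 𝓛.Op) (f : Fin (𝓛.arity p) → Hom₀ A 𝓛.Ω), (∀ i, f i ∈ 𝔄) →
    (Hom₀.tuple f).comp (𝓛.op p) ∈ 𝔄

def DepthOneSeparating : Prop :=
  ∀ (A : Alg₁ M) (hA : Canonical A) (𝔄 : Set (Hom₀ A.zero 𝓛.Ω)),
    JointlyOrderReflecting (Hom₀.map '' 𝔄) → ClosedUnderOps 𝓛 𝔄 →
    JointlyOrderReflecting {g | ∃ L : 𝓛.Mod, ∃ f ∈ 𝔄, g = (𝓛.modExt L hA f).map}

/-! ### The graded monad of iterates of a functor -/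

/-- The `n`-fold composite `G ^ n`. -/
def iter (G : PartOrd.{u} ⥤ PartOrd.{u}) : ℕ → PartOrd.{u} ⥤ PartOrd.{u}
  | 0 => 𝟭 PartOrd.{u}
  | n + 1 => iter G n ⋙ G

theorem iter_comp (G : PartOrd.{u} ⥤ PartOrd.{u}) {n k r : ℕ} (h : n + k = r) :
    iter G k ⋙ iter G n = iter G r := by
  subst h
  induction n with
  | zero => rw [Nat.zero_add]; rfl
  | succ n ih =>
    rw [Nat.succ_add]
    change (iter G k ⋙ iter G n) ⋙ G = iter G (n + k) ⋙ G
    rw [ih]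

/-- The graded monad `M_n = G ^ n`, with all unit and multiplication maps identities. -/
def iterMonad (G : PartOrd.{u} ⥤ PartOrd.{u}) : GradedMonad.{u} where
  T := iter G
  η := 𝟙 (𝟭 PartOrd.{u})
  μ h := eqToHom (iter_comp G h)
  unit_left n X := by
    rw [eqToHom_app]
    exact Category.id_comp _
  unit_right n X := by
    rw [eqToHom_app]
    exact (congrArg (· ≫ 𝟙 ((iter G n).obj X)) ((iter G n).map_id X)).trans (Category.id_comp _)
  assoc hnk hkm ha hb X := by
    simp only [eqToHom_app, eqToHom_map]
    exact (eqToHom_trans _ _).trans (eqToHom_trans _ _).symm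

/-- The identity transformation `G ⟶ M₁` for `M_n = G ^ n`. -/
def iterId (G : PartOrd.{u} ⥤ PartOrd.{u}) : G ⟶ (iterMonad G).T 1 :=
  (Functor.leftUnitor G).inv

theorem iterMonad_str (A : Alg₀ (iterMonad G)) : A.str = 𝟙 A.carrier :=
  (Category.id_comp A.str).symm.trans A.unit

/-- Every monotone map is a morphism of `M₀`-algebras for `M_n = G ^ n`. -/
def iterHom {A B : Alg₀ (iterMonad G)} (f : A.carrier ⟶ B.carrier) : Hom₀ A B where
  map := f
  comm := by
    rw [iterMonad_str A, iterMonad_str B]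
    exact (Category.id_comp f).trans (Category.comp_id f).symm

theorem iterMonad_canonical (G : PartOrd.{u} ⥤ PartOrd.{u}) (n : ℕ) (X : PartOrd.{u}) :
    Canonical (free₁ (iterMonad G) n X) := by
  intro B h₀
  have hmain : (free₁ (iterMonad G) n X).main = 𝟙 (G.obj ((iter G n).obj X)) :=
    eqToHom_app (iter_comp G (Nat.add_comm 1 n)) X
  refine ⟨iterHom (((iterMonad G).T 1).map h₀.map ≫ B.main), ?_, ?_⟩
  · change _ ≫ _ = _
    rw [hmain]
    exact Category.id_comp _
  · intro h₁ hh
    change _ ≫ _ = _ at hh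
    rw [hmain] at hh
    ext1
    exact (Category.id_comp h₁.map).symm.trans hh

/-- A poset as an `M₀`-algebra for `M_n = G ^ n`. -/
def iterAlg₀ (G : PartOrd.{u} ⥤ PartOrd.{u}) (X : PartOrd.{u}) : Alg₀ (iterMonad G) where
  carrier := X
  str := 𝟙 X
  unit := Category.id_comp _
  assoc := by
    change (eqToHom (iter_comp G (Nat.zero_add 0))).app X ≫ 𝟙 X = _
    rw [eqToHom_app]
    rfl

/-! ### Coalgebraic modal logic on posets -/

/-- A monotone predicate lifting for `G`: a natural way to turn monotone predicates on `X` into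
monotone predicates on `G X`. -/
structure PredicateLifting (G : PartOrd.{u} ⥤ PartOrd.{u}) where
  lift : ∀ {X : PartOrd.{u}}, (X ⟶ two.{u}) → (G.obj X ⟶ two.{u})
  natural : ∀ {X Y : PartOrd.{u}} (h : X ⟶ Y) (f : Y ⟶ two.{u}), lift (h ≫ f) = G.map h ≫ lift f

/-- A separating set of monotone predicate liftings. -/
def Separating (Λ : Set (PredicateLifting G)) : Prop :=
  ∀ (X : PartOrd.{u}) (t s : G.obj X),
    (∀ l ∈ Λ, ∀ f : X ⟶ two.{u}, l.lift f t ≤ l.lift f s) → t ≤ s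

/-- Conjunctions and disjunctions of every finite arity, including the empty ones. -/
inductive LatticeOp : Type
  | conj (k : ℕ)
  | disj (k : ℕ)

def LatticeOp.arity : LatticeOp → ℕ
  | conj k => k
  | disj k => k

/-- The interpretation of finite conjunction and disjunction as finite meet and join. -/
def LatticeOp.interp : ∀ p : LatticeOp, powObj two.{u} p.arity ⟶ two.{u}
  | conj _ =>
    PartOrd.ofHom ⟨fun v => Finset.univ.inf v, fun _ _ h => Finset.inf_mono_fun fun i _ => h i⟩
  | disj _ =>
    PartOrd.ofHom ⟨fun v => Finset.univ.sup v, fun _ _ h => Finset.sup_mono_fun fun i _ => h i⟩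

/-- The graded logic over `M_n = G ^ n` with truth values `⊥ < ⊤`, the only truth constant `⊤`,
finite conjunctions and disjunctions, and modalities given by the predicate liftings in `Λ`; the
lifting `l` is interpreted as the map `l(id) : G 2 ⟶ 2`. -/
def coalgLogic (G : PartOrd.{u} ⥤ PartOrd.{u}) (Λ : Set (PredicateLifting G)) :
    GradedLogic.{u, 0, 0, u + 1} (iterMonad G) where
  Ω := iterAlg₀ G two.{u}
  Θ := Unit
  const _ := PartOrd.ofHom ⟨fun _ => (⊤ : ULift.{u} Bool), fun _ _ _ => le_rfl⟩
  Op := LatticeOp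
  arity := LatticeOp.arity
  op p := iterHom p.interp
  Mod := Λ
  modality l := l.1.lift (𝟙 two.{u})
  isMain l := by
    constructor
    · change (eqToHom (iter_comp G (Nat.zero_add 1))).app two.{u} ≫ _ = _
      rw [eqToHom_app]
      exact (Category.id_comp _).trans (Category.comp_id _).symm
    · change (eqToHom (iter_comp G (Nat.add_zero 1))).app two.{u} ≫ _ = G.map (𝟙 two.{u}) ≫ _
      rw [eqToHom_app]
      exact congrArg (· ≫ l.1.lift (𝟙 two.{u})) (G.map_id two.{u}).symm

end GradedSem

end

/-! Everything rests on a reduction to finite posets. A poset is the directed colimit of its finite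
subposets, so two elements of `G X` always come from one `G S` with `S` finite
(`exists_finite_support`).

Depth-1 separation: let `𝔄` be jointly order-reflecting and closed under finite meets and joins. A
monotone predicate on a finite `S` is a join of indicators of principal up-sets, and each of these
is cut out on `S` by a finite meet of separating members of `𝔄`. So every predicate on `S` is the
restriction of a member of `𝔄` (`ClosedUnderOps.exists_extension`), and testing `Λ` on `G S`
requires only members of `𝔄`. The main map of a canonical algebra is surjective
(`Canonical.exists_main_eq`), which carries the conclusion from `G A₀` to `A₁`. Induction on depth
then gives expressiveness for refinement.

Simulation: a finite set of behaviour sequences is already order-embedded by a single stage of the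
final sequence. As `G` preserves embeddings, the images under `G` of the projections to the stages
are jointly order-reflecting (`le_of_map_cone_le`). Hence a coalgebra structure descends to the
poset of its behaviour sequences. Applied to the coproduct of two coalgebras, this quotient is the
common target of the required morphisms. -/

namespace GradedSem

/-! ### Elements of finitary functors -/

/-- The inclusion of a subposet. -/
def incl {X : PartOrd.{u}} (S : Set X) : PartOrd.of S ⟶ X :=
  PartOrd.ofHom ⟨Subtype.val, fun _ _ h => h⟩

/-- Colimit cocones of posets are jointly surjective. -/
theorem exists_ι_eq {J : Type u} [SmallCategory J] {F : J ⥤ PartOrd.{u}} {c : Cocone F}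
    (hc : IsColimit c) (t : c.pt) : ∃ (j : J) (t' : F.obj j), c.ι.app j t' = t := by
  let U : Set c.pt := {t | ∃ (j : J) (t' : F.obj j), c.ι.app j t' = t}
  let d : Cocone F :=
    { pt := PartOrd.of U
      ι :=
        { app := fun j => PartOrd.ofHom
            ⟨fun t' => ⟨c.ι.app j t', j, t', rfl⟩, fun _ _ h => (c.ι.app j).hom.monotone h⟩
          naturality := fun i j f => by
            ext x
            exact Subtype.ext (congrArg (fun q : F.obj i ⟶ c.pt => q x) (c.w f)) } }
  -- Corestricting the legs to their joint image `U` gives a cocone; by uniqueness its mediating map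
  -- splits the inclusion of `U`, so `U` is everything.
  have h : hc.desc d ≫ incl U = 𝟙 c.pt := by
    refine hc.hom_ext fun j => ?_
    rw [← Category.assoc, hc.fac, Category.comp_id]
    rfl
  have ht : incl U (hc.desc d t) = t := congrArg (fun q : c.pt ⟶ c.pt => q t) h
  rw [← ht]
  exact (hc.desc d t).2

/-- The diagram of finite subposets of a poset. -/
def finiteSubposets (X : PartOrd.{u}) : Finset X ⥤ PartOrd.{u} where
  obj S := PartOrd.of (S : Set X)
  map f := PartOrd.ofHom ⟨fun x => ⟨x.1, leOfHom f x.2⟩, fun _ _ h => h⟩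

/-- A poset is a cocone under its finite subposets. -/
def finiteSubposetsCocone (X : PartOrd.{u}) : Cocone (finiteSubposets X) where
  pt := X
  ι := { app := fun S => incl (S : Set X) }

/-- A poset is the directed colimit of its finite subposets. -/
def isColimitFiniteSubposets (X : PartOrd.{u}) : IsColimit (finiteSubposetsCocone X) where
  desc d := PartOrd.ofHom
    { toFun := fun x => d.ι.app ({x} : Finset X) ⟨x, by simp⟩
      monotone' := fun x y hxy => by
        classical
        -- The legs at `{x}` and `{y}` both factor through the leg at `{x, y}`, which is monotone.
        have key : ∀ (z : X) (hz : ({z} : Finset X) ≤ {x, y}),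
            d.ι.app ({z} : Finset X) ⟨z, by simp⟩ =
              d.ι.app ({x, y} : Finset X) ⟨z, hz (by simp)⟩ := fun z hz =>
          (congrArg (fun q : (finiteSubposets X).obj {z} ⟶ d.pt => q ⟨z, by simp⟩)
            (d.w (homOfLE hz))).symm
        exact ((key x (by simp)).trans_le
          ((d.ι.app ({x, y} : Finset X)).hom.monotone hxy)).trans_eq (key y (by simp)).symm }
  fac d S := by
    ext x
    have hx : ({x.1} : Finset X) ≤ S := by simpa using x.2
    exact (congrArg (fun q : (finiteSubposets X).obj {x.1} ⟶ d.pt => q ⟨x.1, by simp⟩)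
      (d.w (homOfLE hx))).symm
  uniq d m hm := by
    ext x
    exact congrArg (fun q : (finiteSubposets X).obj (singleton (α := X) x) ⟶ d.pt =>
      q ⟨x, Finset.mem_singleton_self (α := X) x⟩)
      (hm (singleton (α := X) x))

/-- A pair of elements of a finitary functor is supported on a finite subposet. -/
theorem exists_finite_support {G : PartOrd.{u} ⥤ PartOrd.{u}} (hG : PreservesFilteredColimits G)
    {X : PartOrd.{u}} (t s : G.obj X) :
    ∃ (S : Finset X) (t' s' : G.obj (PartOrd.of (S : Set X))),
      G.map (incl (S : Set X)) t' = t ∧ G.map (incl (S : Set X)) s' = s := by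
  classical
  have hc := isColimitOfPreserves G (isColimitFiniteSubposets X)
  obtain ⟨S₁, t', ht⟩ := exists_ι_eq hc t
  obtain ⟨S₂, s', hs⟩ := exists_ι_eq hc s
  -- The two elements have separate supports; both are pushed forward to the union.
  let f₁ : S₁ ⟶ S₁ ∪ S₂ := homOfLE Finset.subset_union_left
  let f₂ : S₂ ⟶ S₁ ∪ S₂ := homOfLE Finset.subset_union_right
  refine ⟨S₁ ∪ S₂, (finiteSubposets X ⋙ G).map f₁ t', (finiteSubposets X ⋙ G).map f₂ s',
    ?_, ?_⟩
  · rw [← ht]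
    exact congrArg (fun q : (finiteSubposets X ⋙ G).obj S₁ ⟶ G.obj X => q t')
      ((G.mapCocone (finiteSubposetsCocone X)).w f₁)
  · rw [← hs]
    exact congrArg (fun q : (finiteSubposets X ⋙ G).obj S₂ ⟶ G.obj X => q s')
      ((G.mapCocone (finiteSubposetsCocone X)).w f₂)

/-! ### Separation -/

theorem two_le_iff (a b : two.{u}) :
    a ≤ b ↔ (a = (⊤ : ULift.{u} Bool) → b = (⊤ : ULift.{u} Bool)) := by
  obtain ⟨a⟩ := a
  obtain ⟨b⟩ := b
  change a ≤ b ↔ (ULift.up a = ULift.up true → ULift.up b = ULift.up true)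
  cases a <;> cases b <;> simp

theorem two_ext {a b : two.{u}} (h : a = (⊤ : ULift.{u} Bool) ↔ b = (⊤ : ULift.{u} Bool)) :
    a = b :=
  le_antisymm ((two_le_iff a b).2 h.1) ((two_le_iff b a).2 h.2)

theorem finset_sup_eq_top_iff {ι : Type*} (s : Finset ι) (v : ι → ULift.{u} Bool) :
    s.sup v = ⊤ ↔ ∃ i ∈ s, v i = ⊤ := by
  classical
  have hsup : ∀ a b : ULift.{u} Bool, a ⊔ b = ⊤ ↔ a = ⊤ ∨ b = ⊤ := by
    rintro ⟨_ | _⟩ ⟨_ | _⟩ <;> decide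
  have hbot : ¬ (⊥ : ULift.{u} Bool) = ⊤ := fun h =>
    absurd (congrArg ULift.down h) (by decide)
  induction s using Finset.induction_on with
  | empty => simp [hbot]
  | insert a s _ ih => rw [Finset.sup_insert, Finset.exists_mem_insert]; exact (hsup _ _).trans (or_congr_right ih)

theorem finset_inf_eq_top_iff {ι : Type*} (s : Finset ι) (v : ι → ULift.{u} Bool) :
    s.inf v = ⊤ ↔ ∀ i ∈ s, v i = ⊤ := by
  classical
  have hinf : ∀ a b : ULift.{u} Bool, a ⊓ b = ⊤ ↔ a = ⊤ ∧ b = ⊤ := by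
    rintro ⟨_ | _⟩ ⟨_ | _⟩ <;> decide
  induction s using Finset.induction_on with
  | empty => simp
  | insert a s _ ih => rw [Finset.inf_insert, Finset.forall_mem_insert]; exact (hinf _ _).trans (and_congr_right' ih)

section Closed

variable {G : PartOrd.{u} ⥤ PartOrd.{u}} {Λ : Set (PredicateLifting G)}
  {A : Alg₀ (iterMonad G)} {𝔄 : Set (Hom₀ A (coalgLogic G Λ).Ω)}

/-- The operators act on tuples indexed by `Fin k`, so the finite set is enumerated. The empty set
is allowed and yields the constant `⊤`. -/
theorem ClosedUnderOps.exists_inf (hcl : ClosedUnderOps (coalgLogic G Λ) 𝔄) {ι : Type*}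
    (s : Finset ι) (g : ι → Hom₀ A (coalgLogic G Λ).Ω) (hg : ∀ i ∈ s, g i ∈ 𝔄) :
    ∃ k ∈ 𝔄, ∀ a, k.map a = (⊤ : ULift.{u} Bool) ↔
      ∀ i ∈ s, (g i).map a = (⊤ : ULift.{u} Bool) := by
  refine ⟨_, hcl (.conj s.card) (fun i => g (s.equivFin.symm i)) fun i => hg _ (Subtype.prop _),
    fun a => ?_⟩
  refine (finset_inf_eq_top_iff (Finset.univ : Finset (Fin s.card))
    fun i => (g (s.equivFin.symm i)).map a).trans ⟨fun h i hi => ?_, fun h i _ => ?_⟩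
  · have hi' := h (s.equivFin ⟨i, hi⟩) (Finset.mem_univ _)
    rwa [Equiv.symm_apply_apply] at hi'
  · exact h _ (Subtype.prop _)

theorem ClosedUnderOps.exists_sup (hcl : ClosedUnderOps (coalgLogic G Λ) 𝔄) {ι : Type*}
    (s : Finset ι) (g : ι → Hom₀ A (coalgLogic G Λ).Ω) (hg : ∀ i ∈ s, g i ∈ 𝔄) :
    ∃ k ∈ 𝔄, ∀ a, k.map a = (⊤ : ULift.{u} Bool) ↔
      ∃ i ∈ s, (g i).map a = (⊤ : ULift.{u} Bool) := by
  refine ⟨_, hcl (.disj s.card) (fun i => g (s.equivFin.symm i)) fun i => hg _ (Subtype.prop _),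
    fun a => ?_⟩
  refine (finset_sup_eq_top_iff (Finset.univ : Finset (Fin s.card))
    fun i => (g (s.equivFin.symm i)).map a).trans ⟨?_, ?_⟩
  · rintro ⟨i, -, hi⟩
    exact ⟨_, Subtype.prop _, hi⟩
  · rintro ⟨i, hi, h⟩
    refine ⟨s.equivFin ⟨i, hi⟩, Finset.mem_univ _, ?_⟩
    rwa [Equiv.symm_apply_apply]

/-- Every monotone predicate on a finite subposet extends to a member of a jointly
order-reflecting set of predicates that is closed under finite meets and joins. -/
theorem ClosedUnderOps.exists_extension (hcl : ClosedUnderOps (coalgLogic G Λ) 𝔄)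
    (h𝔄 : JointlyOrderReflecting (Hom₀.map '' 𝔄))
    (S : Finset A.carrier) (f : PartOrd.of (S : Set A.carrier) ⟶ two.{u}) :
    ∃ g ∈ 𝔄, incl (S : Set A.carrier) ≫ g.map = f := by
  classical
  have hsep : ∀ x y : A.carrier, ∃ g : Hom₀ A (coalgLogic G Λ).Ω, ¬ x ≤ y →
      g ∈ 𝔄 ∧ g.map x = (⊤ : ULift.{u} Bool) ∧ ¬ g.map y = (⊤ : ULift.{u} Bool) := by
    intro x y
    by_contra! hcon
    have hxy : ¬ x ≤ y := (hcon (iterHom (PartOrd.ofHom ⟨fun _ => (⊤ : ULift.{u} Bool),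
      fun _ _ _ => le_rfl⟩))).1
    refine hxy (h𝔄 x y ?_)
    rintro _ ⟨g, hg, rfl⟩
    exact (two_le_iff _ _).2 fun h => (hcon g).2 hg h
  choose h hh using hsep
  -- For `x ∈ S`, this meet restricts on `S` to the indicator of the elements above `x`: any other
  -- `y ∈ S` is rejected by `h x y`.
  have hinf : ∀ x : A.carrier, ∃ k ∈ 𝔄, ∀ a, k.map a = (⊤ : ULift.{u} Bool) ↔
      ∀ y ∈ S.filter (fun y => ¬ x ≤ y), (h x y).map a = (⊤ : ULift.{u} Bool) := fun x =>
    hcl.exists_inf _ _ fun y hy => (hh x y (Finset.mem_filter.1 hy).2).1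
  choose k hk𝔄 hk using hinf
  -- A monotone `f` is the join of the indicators of the up-sets generated by the points where it is
  -- true.
  obtain ⟨g, hg, hgk⟩ := hcl.exists_sup
    (Finset.univ.filter fun x : S => f x = (⊤ : ULift.{u} Bool))
    (fun x => k x.1) fun x _ => hk𝔄 x.1
  refine ⟨g, hg, ?_⟩
  ext a
  refine two_ext ((hgk a.1).trans ⟨?_, fun ha => ?_⟩)
  · rintro ⟨x, hx, hxa⟩
    have hle : x.1 ≤ a.1 := by
      by_contra hle
      exact (hh x.1 a.1 hle).2.2 ((hk x.1 a.1).1 hxa a.1 (Finset.mem_filter.2 ⟨a.2, hle⟩))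
    exact (two_le_iff _ _).1 (f.hom.monotone hle) (Finset.mem_filter.1 hx).2
  · exact ⟨a, Finset.mem_filter.2 ⟨Finset.mem_univ _, ha⟩, (hk a.1 a.1).2 fun y hy =>
      (hh a.1 y (Finset.mem_filter.1 hy).2).2.1⟩

/-- Liftings of a closed jointly order-reflecting set of predicates are jointly
order-reflecting. -/
theorem ClosedUnderOps.le_of_lift_le (hG : PreservesFilteredColimits G)
    (hΛ : Separating Λ)
    (hcl : ClosedUnderOps (coalgLogic G Λ) 𝔄) (h𝔄 : JointlyOrderReflecting (Hom₀.map '' 𝔄))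
    (t s : G.obj A.carrier)
    (h : ∀ l ∈ Λ, ∀ g ∈ 𝔄, (G.map g.map ≫ l.lift (𝟙 two.{u})) t ≤
      (G.map g.map ≫ l.lift (𝟙 two.{u})) s) : t ≤ s := by
  obtain ⟨S, t', s', rfl, rfl⟩ := exists_finite_support hG t s
  refine (G.map _).hom.monotone (hΛ _ t' s' fun l hl f => ?_)
  obtain ⟨g, hg, rfl⟩ := hcl.exists_extension h𝔄 S f
  -- By naturality a lifting is determined by its value at the identity of `two`, which is the form
  -- in which the logic uses it.
  have e : l.lift (incl (S : Set A.carrier) ≫ g.map) =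
      G.map (incl _) ≫ G.map g.map ≫ l.lift (𝟙 two.{u}) := by
    rw [← Category.assoc, ← G.map_comp]
    exact (congrArg l.lift (Category.comp_id _).symm).trans (l.natural _ _)
  exact (congrArg (fun q : G.obj _ ⟶ two.{u} => q t') e).trans_le
    ((h l hl g hg).trans_eq (congrArg (fun q : G.obj _ ⟶ two.{u} => q s') e).symm)

end Closed

/-- Every monotone map is a main structure map for `M_n = G ^ n`. -/
theorem iterMonad_isMain {G : PartOrd.{u} ⥤ PartOrd.{u}} (A₀ A₁ : Alg₀ (iterMonad G))
    (a : G.obj A₀.carrier ⟶ A₁.carrier) : IsMain A₀ A₁ a where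
  hom := by
    rw [iterMonad_str A₁]
    refine Eq.trans ?_ (Category.comp_id a).symm
    exact (congrArg (· ≫ a) (eqToHom_app (iter_comp G (Nat.zero_add 1)) A₀.carrier)).trans
      (Category.id_comp a)
  coeq := by
    rw [iterMonad_str A₀]
    refine Eq.trans ?_ (congrArg (· ≫ a) (G.map_id A₀.carrier)).symm
    exact congrArg (· ≫ a) (eqToHom_app (iter_comp G (Nat.add_zero 1)) A₀.carrier)

/-- The main structure map of a canonical algebra is surjective. -/
theorem Canonical.exists_main_eq {G : PartOrd.{u} ⥤ PartOrd.{u}} {A : Alg₁ (iterMonad G)}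
    (hA : Canonical A) (t : A.one.carrier) : ∃ t', A.main t' = t := by
  let main' : G.obj A.zero.carrier ⟶ PartOrd.of (Set.range A.main) :=
    PartOrd.ofHom ⟨fun t' => ⟨A.main t', t', rfl⟩, fun _ _ h => A.main.hom.monotone h⟩
  let B : Alg₁ (iterMonad G) :=
    { zero := A.zero
      one := iterAlg₀ G (PartOrd.of (Set.range A.main))
      main := main'
      isMain := iterMonad_isMain _ _ _ }
  obtain ⟨r, hr, -⟩ := hA B (iterHom (𝟙 _))
  obtain ⟨e, -, he⟩ := hA A (iterHom (𝟙 _))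
  have hmap : ((iterMonad G).T 1).map (𝟙 A.zero.carrier) = 𝟙 _ := CategoryTheory.Functor.map_id _ _
  -- Extending the identity of `A₀` to the range of the main map and then including gives an
  -- endomorphism that extends the identity; so does the identity of `A₁`. By uniqueness they agree,
  -- so the range is all of `A₁`.
  have h₁ : iterHom (r.map ≫ incl (Set.range A.main)) = e := by
    refine he _ ?_
    change A.main ≫ r.map ≫ incl (Set.range A.main) =
      ((iterMonad G).T 1).map (𝟙 A.zero.carrier) ≫ A.main
    change A.main ≫ r.map = ((iterMonad G).T 1).map (𝟙 A.zero.carrier) ≫ main' at hr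
    exact (Category.assoc _ _ _).symm.trans
      ((congrArg (· ≫ incl (Set.range A.main)) hr).trans (Category.assoc _ _ _))
  have h₂ : iterHom (𝟙 _) = e := by
    refine he _ ?_
    change A.main ≫ 𝟙 _ = ((iterMonad G).T 1).map (𝟙 A.zero.carrier) ≫ A.main
    rw [hmap, Category.comp_id, Category.id_comp]
  have h₃ : incl (Set.range A.main) (r.map t) = t :=
    congrArg (fun q : Hom₀ A.one A.one => q.map t) (h₁.trans h₂.symm)
  rw [← h₃]
  exact (r.map t).2

/-- `M₀ 1` is a single point, so there is nothing to separate. -/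
theorem depthZeroSeparating (G : PartOrd.{u} ⥤ PartOrd.{u}) (Λ : Set (PredicateLifting G)) :
    DepthZeroSeparating (coalgLogic G Λ) :=
  fun _ _ _ => le_rfl

theorem modExt_main {M : GradedMonad.{u}} (𝓛 : GradedLogic.{u, w₁, w₂, w₃} M) (L : 𝓛.Mod)
    {A : Alg₁ M} (hA : Canonical A) (f : Hom₀ A.zero 𝓛.Ω) :
    A.main ≫ (𝓛.modExt L hA f).map = (M.T 1).map f.map ≫ 𝓛.modality L :=
  (hA (𝓛.modAlg L) f).choose_spec.1

theorem depthOneSeparating {G : PartOrd.{u} ⥤ PartOrd.{u}} (hG : PreservesFilteredColimits G)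
    {Λ : Set (PredicateLifting G)} (hΛ : Separating Λ) :
    DepthOneSeparating (coalgLogic G Λ) := by
  intro A hA 𝔄 h𝔄 hcl t s h
  obtain ⟨t', rfl⟩ := hA.exists_main_eq t
  obtain ⟨s', rfl⟩ := hA.exists_main_eq s
  refine A.main.hom.monotone (hcl.le_of_lift_le hG hΛ h𝔄 t' s' fun l hl g hg => ?_)
  have e := modExt_main (coalgLogic G Λ) ⟨l, hl⟩ hA g
  change ((((iterMonad G).T 1).map g.map ≫ (coalgLogic G Λ).modality ⟨l, hl⟩ : _)) t' ≤
    ((((iterMonad G).T 1).map g.map ≫ (coalgLogic G Λ).modality ⟨l, hl⟩ : _)) s'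
  rw [← e]
  exact h _ ⟨⟨l, hl⟩, g, hg, rfl⟩

/-! ### Expressiveness for graded refinement -/

/-- Depth-1 separation on `(M_n 1, M_{n+1} 1)` is the induction step: the evaluations of depth-`n`
formulae are closed under the operators because the syntax is. -/
theorem eval_jointlyOrderReflecting {G : PartOrd.{u} ⥤ PartOrd.{u}}
    (hG : PreservesFilteredColimits G)
    {Λ : Set (PredicateLifting G)} (hΛ : Separating Λ) (n : ℕ) :
    JointlyOrderReflecting (Hom₀.map '' Set.range fun φ : Formula (coalgLogic G Λ) n =>
      eval (coalgLogic G Λ) (fun n => iterMonad_canonical G n one) φ) := by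
  induction n with
  | zero => exact fun _ _ _ => le_rfl
  | succ n ih =>
    intro t s h
    refine depthOneSeparating hG hΛ _ (iterMonad_canonical G n one) _ ih ?_ t s ?_
    · intro p f hf
      choose φ hφ using hf
      refine ⟨.op p φ, ?_⟩
      rw [← funext hφ]
      rfl
    · rintro _ ⟨L, _, ⟨φ, rfl⟩, rfl⟩
      exact h _ ⟨_, ⟨.mod L φ, rfl⟩, rfl⟩

theorem expressive {G : PartOrd.{u} ⥤ PartOrd.{u}}
    (hG : PreservesFilteredColimits G)
    {Λ : Set (PredicateLifting G)} (hΛ : Separating Λ) :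
    Expressive (coalgLogic G Λ) (fun n => iterMonad_canonical G n one) (iterId G) := by
  intro C D x y h n
  refine eval_jointlyOrderReflecting hG hΛ n _ _ ?_
  rintro _ ⟨_, ⟨φ, rfl⟩, rfl⟩
  exact h n φ

/-! ### Simulation -/

section Simulation

variable {G : PartOrd.{u} ⥤ PartOrd.{u}}

/-- The connecting maps of the final sequence of a functor. -/
def finalSeqMap (G : PartOrd.{u} ⥤ PartOrd.{u}) :
    ∀ n, (iter G (n + 1)).obj one.{u} ⟶ (iter G n).obj one.{u}
  | 0 => bang _
  | n + 1 => G.map (finalSeqMap G n)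

/-- The `n`-step behaviour of states of a coalgebra in the final sequence. -/
def stepBehaviour (C : Endofunctor.Coalgebra G) : ∀ n, C.V ⟶ (iter G n).obj one.{u}
  | 0 => bang _
  | n + 1 => C.str ≫ G.map (stepBehaviour C n)

/-- As the multiplications are identities, graded behaviour is the canonical cone over the final
sequence, which has a plain recursion. -/
theorem behaviourOne_eq (C : Endofunctor.Coalgebra G) (n : ℕ) :
    behaviourOne (M := iterMonad G) (iterId G) C n = stepBehaviour C n := by
  induction n with
  | zero => rfl
  | succ n ih =>
    have hμ : ((iterMonad G).μ (Nat.add_comm 1 n)).app C.V =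
        𝟙 (G.obj ((iter G n).obj C.V)) :=
      eqToHom_app (iter_comp G (Nat.add_comm 1 n)) C.V
    have hb : behaviour (M := iterMonad G) (iterId G) C (n + 1) =
        C.str ≫ G.map (behaviour (M := iterMonad G) (iterId G) C n) := by
      change C.str ≫ 𝟙 _ ≫ G.map _ ≫ _ = _
      rw [hμ]
      rfl
    change behaviour (M := iterMonad G) (iterId G) C (n + 1) ≫
      G.map (((iterMonad G).T n).map (bang C.V)) = C.str ≫ G.map (stepBehaviour C n)
    rw [hb, ← ih]
    exact (Category.assoc _ _ _).trans (congrArg (C.str ≫ ·) (G.map_comp _ _).symm)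

theorem stepBehaviour_finalSeqMap (C : Endofunctor.Coalgebra G) (n : ℕ) :
    stepBehaviour C (n + 1) ≫ finalSeqMap G n = stepBehaviour C n := by
  induction n with
  | zero => rfl
  | succ n ih =>
    change (C.str ≫ G.map (stepBehaviour C (n + 1))) ≫ G.map (finalSeqMap G n) =
      C.str ≫ G.map (stepBehaviour C n)
    rw [Category.assoc, ← G.map_comp, ih]

theorem hom_stepBehaviour {C D : Endofunctor.Coalgebra G} (f : C ⟶ D) (n : ℕ) :
    f.f ≫ stepBehaviour D n = stepBehaviour C n := by
  induction n with
  | zero => rfl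
  | succ n ih =>
    change f.f ≫ D.str ≫ G.map (stepBehaviour D n) = C.str ≫ G.map (stepBehaviour C n)
    rw [← Category.assoc, ← f.h, Category.assoc, ← G.map_comp, ih]

/-- A finitary functor that preserves embeddings sends a jointly order-reflecting cone over the
final sequence to a jointly order-reflecting family. -/
theorem le_of_map_cone_le (hG : PreservesFilteredColimits G) (hemb : PreservesEmbeddings G)
    {Q : PartOrd.{u}} (q : ∀ n, Q ⟶ (iter G n).obj one.{u})
    (hq : ∀ n, q (n + 1) ≫ finalSeqMap G n = q n)
    (hrefl : ∀ a b : Q, (∀ n, q n a ≤ q n b) → a ≤ b) (t s : G.obj Q)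
    (h : ∀ n, G.map (q n) t ≤ G.map (q n) s) : t ≤ s := by
  obtain ⟨S, t', s', rfl, rfl⟩ := exists_finite_support hG t s
  have hstep : ∀ (n : ℕ) (a b : Q), q (n + 1) a ≤ q (n + 1) b → q n a ≤ q n b := by
    intro n a b hab
    rw [← hq n]
    exact (finalSeqMap G n).hom.monotone hab
  -- Later stages are finer, so a failure of the order seen at one stage persists at all later ones.
  -- The maximum of the witnessing stages over the finitely many pairs in `S` thus serves all pairs
  -- at once.
  have hanti : ∀ (a b : Q) {m n : ℕ}, m ≤ n → q n a ≤ q n b → q m a ≤ q m b := by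
    intro a b m n hmn
    induction hmn with
    | refl => exact id
    | step _ ih => exact fun h => ih (hstep _ a b h)
  have hex : ∀ a b : Q, ∃ n, q n a ≤ q n b → a ≤ b := by
    intro a b
    by_contra! hcon
    exact (hcon 0).2 (hrefl a b fun n => (hcon n).1)
  choose N hN using hex
  let m := (S ×ˢ S).sup fun p => N p.1 p.2
  have hm : IsEmbedding (incl (S : Set Q) ≫ q m) := fun a b hab =>
    hN a.1 b.1 (hanti a.1 b.1 (Finset.le_sup (f := fun p : Q × Q => N p.1 p.2)
      (Finset.mem_product.2 ⟨a.2, b.2⟩ : (a.1, b.1) ∈ S ×ˢ S)) hab)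
  refine (G.map (incl (S : Set Q))).hom.monotone (hemb _ _ _ hm t' s' ?_)
  rw [G.map_comp]
  exact h m

/-- Every coalgebra has a quotient ordered by finite-step behaviour. -/
theorem exists_quotient (hG : PreservesFilteredColimits G) (hemb : PreservesEmbeddings G)
    (W : Endofunctor.Coalgebra G) :
    ∃ (Z : Endofunctor.Coalgebra G) (f : W ⟶ Z),
      ∀ a b : W.V, (∀ n, stepBehaviour W n a ≤ stepBehaviour W n b) → f.f a ≤ f.f b := by
  let β : W.V → ∀ n, (iter G n).obj one.{u} := fun w n => stepBehaviour W n w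
  let Q : PartOrd.{u} := PartOrd.of (Set.range β)
  let e : W.V ⟶ Q := PartOrd.ofHom
    ⟨fun w => ⟨β w, w, rfl⟩, fun _ _ h n => (stepBehaviour W n).hom.monotone h⟩
  let q : ∀ n, Q ⟶ (iter G n).obj one.{u} := fun n =>
    PartOrd.ofHom ⟨fun z => z.1 n, fun _ _ h => h n⟩
  have heq : ∀ n, e ≫ q n = stepBehaviour W n := fun _ => rfl
  have hq : ∀ n, q (n + 1) ≫ finalSeqMap G n = q n := by
    intro n
    ext ⟨_, w, rfl⟩
    exact congrArg (fun r : W.V ⟶ (iter G n).obj one.{u} => r w) (stepBehaviour_finalSeqMap W n)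
  -- Stage `n + 1` of the behaviour of `w` is the image under `G.map (q n)` of its successor
  -- structure in `G Q`. This makes the structure on `Q` monotone and independent of the
  -- representatives `σ`.
  have hmono : ∀ a b : W.V, (∀ n, stepBehaviour W n a ≤ stepBehaviour W n b) →
      G.map e (W.str a) ≤ G.map e (W.str b) := by
    intro a b hab
    refine le_of_map_cone_le hG hemb q hq (fun _ _ h n => h n) _ _ fun n => ?_
    have h₁ : ∀ w : W.V, G.map (q n) (G.map e (W.str w)) = stepBehaviour W (n + 1) w := by
      intro w
      change (G.map e ≫ G.map (q n)) (W.str w) = G.map (stepBehaviour W n) (W.str w)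
      rw [← G.map_comp, heq]
    exact (h₁ a).trans_le ((hab (n + 1)).trans_eq (h₁ b).symm)
  choose σ hσ using fun z : Q => z.2
  let ζ : Q ⟶ G.obj Q := PartOrd.ofHom
    { toFun := fun z => G.map e (W.str (σ z))
      monotone' := fun z z' h => hmono _ _ fun n =>
        (congrFun (hσ z) n).trans_le ((h n).trans_eq (congrFun (hσ z') n).symm) }
  refine ⟨⟨Q, ζ⟩, ⟨e, ?_⟩, fun a b h n => h n⟩
  ext w
  exact le_antisymm (hmono _ _ fun n => (congrFun (hσ (e w)) n).ge)
    (hmono _ _ fun n => (congrFun (hσ (e w)) n).le)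

/-- The left coproduct injection of posets. -/
def sumInl (X Y : PartOrd.{u}) : X ⟶ PartOrd.of (X ⊕ Y) :=
  PartOrd.ofHom ⟨Sum.inl, Sum.inl_mono⟩

/-- The right coproduct injection of posets. -/
def sumInr (X Y : PartOrd.{u}) : Y ⟶ PartOrd.of (X ⊕ Y) :=
  PartOrd.ofHom ⟨Sum.inr, Sum.inr_mono⟩

/-- Copairing of monotone maps. -/
def sumDesc {X Y Z : PartOrd.{u}} (f : X ⟶ Z) (g : Y ⟶ Z) : PartOrd.of (X ⊕ Y) ⟶ Z :=
  PartOrd.ofHom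
    { toFun := Sum.elim f g
      monotone' := by
        rintro _ _ (h | h)
        · exact f.hom.monotone h
        · exact g.hom.monotone h }

/-- The coproduct of coalgebras. -/
def sumCoalgebra (C D : Endofunctor.Coalgebra G) : Endofunctor.Coalgebra G where
  V := PartOrd.of (C.V ⊕ D.V)
  str := sumDesc (C.str ≫ G.map (sumInl C.V D.V)) (D.str ≫ G.map (sumInr C.V D.V))

/-- States related by all finite-step behaviours are related by simulation. -/
theorem simulates_of_stepBehaviour_le (hG : PreservesFilteredColimits G)
    (hemb : PreservesEmbeddings G) (C D : Endofunctor.Coalgebra G) (x : C.V) (y : D.V)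
    (h : ∀ n, stepBehaviour C n x ≤ stepBehaviour D n y) : Simulates C D x y := by
  -- The coproduct puts both states into one coalgebra, and morphisms preserve finite-step
  -- behaviour.
  let i : C ⟶ sumCoalgebra C D := ⟨sumInl C.V D.V, rfl⟩
  let j : D ⟶ sumCoalgebra C D := ⟨sumInr C.V D.V, rfl⟩
  obtain ⟨Z, f, hf⟩ := exists_quotient hG hemb (sumCoalgebra C D)
  refine ⟨Z, i ≫ f, j ≫ f, hf (i.f x) (j.f y) fun n => ?_⟩
  have hx := congrArg (fun r : C.V ⟶ (iter G n).obj one.{u} => r x) (hom_stepBehaviour i n)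
  have hy := congrArg (fun r : D.V ⟶ (iter G n).obj one.{u} => r y) (hom_stepBehaviour j n)
  exact hx.trans_le ((h n).trans_eq hy.symm)

end Simulation

end GradedSem

theorem mainTheorem5 (G : PartOrd.{u} ⥤ PartOrd.{u}) (hfin : PreservesFilteredColimits G)
    (henr : GradedSem.IsEnriched G) (hemb : GradedSem.PreservesEmbeddings G)
    (hsurj : GradedSem.PreservesSurjections G)
    (Λ : Set (GradedSem.PredicateLifting G)) (hΛ : GradedSem.Separating Λ) :
    GradedSem.DepthZeroSeparating (GradedSem.coalgLogic G Λ) ∧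
    GradedSem.DepthOneSeparating (GradedSem.coalgLogic G Λ) ∧
    GradedSem.Expressive (GradedSem.coalgLogic G Λ)
      (fun n => GradedSem.iterMonad_canonical G n GradedSem.one) (GradedSem.iterId G) ∧
    GradedSem.ExpressiveForSimulation (GradedSem.coalgLogic G Λ)
      (fun n => GradedSem.iterMonad_canonical G n GradedSem.one) (GradedSem.iterId G) := by
  have hexp := GradedSem.expressive hfin hΛ
  refine ⟨GradedSem.depthZeroSeparating G Λ, GradedSem.depthOneSeparating hfin hΛ, hexp,
    fun C D x y h => GradedSem.simulates_of_stepBehaviour_le hfin hemb C D x y fun n => ?_⟩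
  rw [← GradedSem.behaviourOne_eq, ← GradedSem.behaviourOne_eq]
  exact hexp C D x y h n
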